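/- Let $R$ be a Noetherian normal domain (an integral domain that is integrally closed in its field of fractions) of Krull dimension at least $2$, let $M$ be a finitely generated reflexive $R$-module (the canonical map $M\to M^{**}$ is bijective), let $s\ge 0$, and let $\varphi\colon R^s\to M$ be an $R$-module homomorphism. Let $0\to M\xrightarrow{\iota}F\to X\to 0$ be an exact sequence of $R$-modules with $F$ free and $X$ torsionfree. For a homomorphism $\psi$ of free $R$-modules let $I_t(\psi)$ be the ideal of $R$ generated by the $t\times t$ minors of a matrix representing $\psi$ (it does not depend on the chosen bases; the only $0\times 0$ minor is $1$). The height of an ideal is the infimum of the heights of its minimal primes; in particular, the unit ideal has height $\infty$. (1) The map $\varphi$ is injective with torsionfree cokernel if and only if $\operatorname{height} I_s(\iota\circ\varphi)\ge 2$. (2) Suppose moreover that $M$ has rank $r\ge 1$ and $s=r-1$. Then $$0\to R^{r-1}\xrightarrow{\varphi}M\to\operatorname{Coker}(\varphi)\to 0$$ is a Bourbaki sequence of $M$ if and only if $\operatorname{height} I_{r-1}(\iota\circ\varphi)\ge 2$. Here a Bourbaki sequence of $M$ is a short exact sequence $0\to G\to M\to I\to 0$ of $R$-modules in which $G$ is free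 and $I$ is isomorphic to an ideal of $R$. -/

import Mathlib

namespace BourbakiSeq

/-- The ideal generated by the `t`-minors of a matrix `A`: the determinants of the matrices formed
by `t` distinct rows and `t` distinct columns of `A` (the order in which they are listed only
affects the sign). The only `0`-minor is `1`. -/
def matrixMinorIdeal {R m n : Type*} [CommRing R] (t : ℕ) (A : Matrix m n R) : Ideal R :=
  Ideal.span {d | ∃ (p : Fin t ↪ m) (q : Fin t ↪ n), d = (A.submatrix p q).det}

/-- The matrix of a linear map with respect to bases of source and target (the `j`-th column holds
the coordinates of the image of the `j`-th basis vector). -/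
noncomputable def matrixOf {R E F m n : Type*} [CommRing R] [AddCommGroup E] [Module R E] [AddCommGroup F]
    [Module R F] (b : Module.Basis n R E) (c : Module.Basis m R F) (f : E →ₗ[R] F) :
    Matrix m n R :=
  Matrix.of fun i j => c.repr (f (b j)) i

/-- The ideal `I_t(f)` of `t`-minors of a linear map between free modules: the ideal generated by
the `t`-minors of a matrix representing `f`. It does not depend on the bases chosen here, see
`minorIdeal_eq`. -/
noncomputable def minorIdeal {R E F : Type*} [CommRing R] [AddCommGroup E] [Module R E]
    [AddCommGroup F] [Module R F] [Module.Free R E] [Module.Free R F] (t : ℕ) (f : E →ₗ[R] F) :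
    Ideal R :=
  matrixMinorIdeal t
    (matrixOf (Module.Free.chooseBasis R E) (Module.Free.chooseBasis R F) f)

theorem det_submatrix_mem {R m n : Type*} [CommRing R] (t : ℕ) (A : Matrix m n R)
    (p : Fin t → m) (q : Fin t → n) : (A.submatrix p q).det ∈ matrixMinorIdeal t A := by
  by_cases hp : Function.Injective p
  · by_cases hq : Function.Injective q
    · exact Ideal.subset_span ⟨⟨p, hp⟩, ⟨q, hq⟩, rfl⟩
    · obtain ⟨i, j, hij, hne⟩ : ∃ i j, q i = q j ∧ i ≠ j := by
        simpa [Function.Injective] using hq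
      rw [Matrix.det_zero_of_column_eq hne (fun k => by simp [hij])]
      exact zero_mem _
  · obtain ⟨i, j, hij, hne⟩ : ∃ i j, p i = p j ∧ i ≠ j := by
      simpa [Function.Injective] using hp
    rw [Matrix.det_zero_of_row_eq hne (by ext k; simp [hij])]
    exact zero_mem _

theorem det_mem_of_span {R ι : Type*} [CommRing R] (t : ℕ) (S : Ideal R)
    (w : ι → Fin t → R) (hw : ∀ p : Fin t → ι, (Matrix.of fun i => w (p i)).det ∈ S)
    (A : Matrix (Fin t) (Fin t) R) (hA : ∀ i, A i ∈ Submodule.span R (Set.range w)) :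
    A.det ∈ S := by
  choose x hx using fun i => (Finsupp.mem_span_range_iff_exists_finsupp).1 (hA i)
  let G : MultilinearMap R (fun _ : Fin t => ι →₀ R) (R ⧸ S) :=
    (Submodule.mkQ S).compMultilinearMap
      ((Matrix.detRowAlternating (R := R) (n := Fin t)).toMultilinearMap.compLinearMap
        (fun _ => Finsupp.linearCombination R w))
  have hG : G = 0 := by
    refine Module.Basis.ext_multilinear (fun _ => Finsupp.basisSingleOne) (fun p => ?_)
    have := hw p
    have h0 : Matrix.detRowAlternating (R := R) (fun i => w (p i)) ∈ S := this
    simpa [G] using (Submodule.Quotient.mk_eq_zero S).2 h0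
  have h := congrArg (fun g => g x) hG
  have hx' : (fun i => Finsupp.linearCombination R w (x i)) = A := by
    funext i
    exact hx i
  have h2 : (Submodule.Quotient.mk (p := S) A.det) = 0 := by
    rw [← hx']
    exact h
  exact (Submodule.Quotient.mk_eq_zero S).1 h2

theorem matrixMinorIdeal_le {R E F m n m' n' : Type*} [CommRing R] [AddCommGroup E] [Module R E]
    [AddCommGroup F] [Module R F] (b : Module.Basis n R E) (c : Module.Basis m R F)
    (b' : Module.Basis n' R E) (c' : Module.Basis m' R F) (t : ℕ) (f : E →ₗ[R] F) :
    matrixMinorIdeal t (matrixOf b' c' f) ≤ matrixMinorIdeal t (matrixOf b c f) := by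
  refine Ideal.span_le.2 ?_
  rintro _ ⟨p, q, rfl⟩
  -- expand the columns in the basis `b`, then the rows in the basis `c`
  have h1 : ∀ r : Fin t → n, (Matrix.of fun i j => c'.repr (f (b (r j))) (p i)).det ∈
      matrixMinorIdeal t (matrixOf b c f) := by
    intro r
    refine det_mem_of_span t _ (fun k j => c.repr (f (b (r j))) k)
      (fun u => det_submatrix_mem t (matrixOf b c f) u r) _ (fun i => ?_)
    classical
    let D : Finset m := Finset.univ.biUnion fun j => (c.repr (f (b (r j)))).support
    have : (fun j => c'.repr (f (b (r j))) (p i)) =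
        ∑ k ∈ D, (c'.repr (c k) (p i)) • (fun j => c.repr (f (b (r j))) k) := by
      funext j
      have hs : (c.repr (f (b (r j)))).support ⊆ D := fun k hk =>
        Finset.mem_biUnion.2 ⟨j, Finset.mem_univ _, hk⟩
      conv_lhs => rw [← c.linearCombination_repr (f (b (r j)))]
      rw [Finsupp.linearCombination_apply, Finsupp.sum_of_support_subset _ hs _ (by simp)]
      simp [Finset.sum_apply, mul_comm]
    change (fun j => c'.repr (f (b (r j))) (p i)) ∈ _
    rw [this]
    exact Submodule.sum_mem _ fun k _ => Submodule.smul_mem _ _ (Submodule.subset_span ⟨k, rfl⟩)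
  rw [SetLike.mem_coe, ← Matrix.det_transpose]
  refine det_mem_of_span t _ (fun k i => c'.repr (f (b k)) (p i))
    (fun r => ?_) _ (fun j => ?_)
  · rw [← Matrix.det_transpose]
    exact h1 r
  · let L : E →ₗ[R] (Fin t → R) :=
      LinearMap.pi fun i => (Finsupp.lapply (p i)) ∘ₗ c'.repr.toLinearMap ∘ₗ f
    have h2 : L (b' (q j)) ∈ Submodule.map L (Submodule.span R (Set.range b)) :=
      ⟨b' (q j), by simp, rfl⟩
    rw [Submodule.map_span, ← Set.range_comp] at h2
    exact h2

theorem minorIdeal_eq {R E F m n : Type*} [CommRing R] [AddCommGroup E] [Module R E]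
    [AddCommGroup F] [Module R F] [Module.Free R E] [Module.Free R F] (b : Module.Basis n R E)
    (c : Module.Basis m R F) (t : ℕ) (f : E →ₗ[R] F) :
    minorIdeal t f = matrixMinorIdeal t (matrixOf b c f) :=
  le_antisymm (matrixMinorIdeal_le _ _ _ _ t f) (matrixMinorIdeal_le _ _ _ _ t f)

/-- `0 → G --f--> M --g--> N → 0` is a Bourbaki sequence of `M`: it is a short exact sequence, `G`
is free, and `N` is (isomorphic to) an ideal of `R`. -/
structure IsBourbakiSequence {R G M N : Type*} [CommRing R] [AddCommGroup G] [Module R G]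
    [AddCommGroup M] [Module R M] [AddCommGroup N] [Module R N]
    (f : G →ₗ[R] M) (g : M →ₗ[R] N) : Prop where
  free : Module.Free R G
  injective : Function.Injective f
  exact : Function.Exact f g
  surjective : Function.Surjective g
  ideal : ∃ I : Ideal R, Nonempty (N ≃ₗ[R] I)

end BourbakiSeq

namespace BourbakiSeq

open Matrix

/-! Write ψ = ι ∘ φ; both directions of (1) play the minors of ψ against normality. If φ is
injective with torsion-free cokernel and a prime P of height < 2 contains I_s(ψ), the columns of ψ
are dependent mod P: ψ(a) ∈ PF with some a_i ∉ P. Injectivity gives P ≠ 0, so P is locally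
principal: uP ⊆ (t) with u ∉ P and t ∈ P. Then ψ(ua) = ty. Torsion-freeness of X puts y in M, that
of the cokernel gives y = φ(b), and ua = tb contradicts a_i ∉ P. Conversely, a nonzero minor makes ψ
injective by Cramer's rule. If φ(a) = dm with d ≠ 0, Cramer gives d ∣ z a_i for all z ∈ I_s(ψ).
Height ≥ 2 and normality yield d ∣ a_i, so m ∈ im φ. For (2), the cokernel has rank one, and a
finitely generated module of rank one is an ideal up to isomorphism exactly when it is torsion-free.
-/

/-- If a prime `P` of a Noetherian integrally closed domain is of the form `(d : y)` with `d ≠ 0`,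
then `P` becomes principal after localizing at `P`: some `u ∉ P` satisfies `u P ⊆ (t)`. -/
theorem exists_notMem_forall_dvd_mul_of_prime_colon {R : Type*} [CommRing R] [IsDomain R]
    [IsNoetherianRing R] [IsIntegrallyClosed R] {P : Ideal R} [hP : P.IsPrime] {d y : R}
    (hd : d ≠ 0) (h : ∀ x, x ∈ P ↔ d ∣ x * y) :
    ∃ t ∈ P, ∃ u ∉ P, t ≠ 0 ∧ ∀ z ∈ P, t ∣ z * u := by
  -- With q = y/d, the hypothesis says P = {x : xq ∈ R}. Either qP ⊄ P, and t with tq = u ∉ P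
  -- generates P locally, or qP ⊆ P, so q is integral, lies in R, and 1 ∈ P.
  by_cases hJ : ∃ t ∈ P, ∃ u ∉ P, t * y = d * u
  · obtain ⟨t, ht, u, hu, htu⟩ := hJ
    have ht0 : t ≠ 0 := by
      rintro rfl
      rw [zero_mul, zero_eq_mul] at htu
      exact hu (htu.resolve_left hd ▸ P.zero_mem)
    refine ⟨t, ht, u, hu, ht0, fun z hz => ?_⟩
    obtain ⟨w, hw⟩ := (h z).1 hz
    exact ⟨w, mul_left_cancel₀ hd (by linear_combination z * (-htu) + t * hw)⟩
  · push Not at hJ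
    have hdK : algebraMap R (FractionRing R) d ≠ 0 := by simpa using hd
    have hdP : d ∈ P := (h d).2 (dvd_mul_right _ _)
    have hint : IsIntegral R (algebraMap R (FractionRing R) y / algebraMap R (FractionRing R) d) := by
      refine isIntegral_of_smul_mem_submodule (Submodule.map (Algebra.linearMap R (FractionRing R)) P) ?_
        (Submodule.FG.map _ (IsNoetherian.noetherian P)) _ ?_
      · exact (Submodule.ne_bot_iff _).2 ⟨_, ⟨d, hdP, rfl⟩, hdK⟩
      · rintro _ ⟨z, hz, rfl⟩
        obtain ⟨w, hw⟩ := (h z).1 hz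
        refine ⟨w, by_contra fun hw' => hJ z hz w hw' hw, ?_⟩
        have := congrArg (algebraMap R (FractionRing R)) hw
        simp only [map_mul] at this
        simp only [Algebra.linearMap_apply, smul_eq_mul]
        field_simp
        linear_combination -this
    obtain ⟨q, hq⟩ := IsIntegrallyClosed.algebraMap_eq_of_integral hint
    refine absurd ((h 1).2 ⟨q, ?_⟩) ((Ideal.ne_top_iff_one P).1 hP.ne_top)
    apply IsFractionRing.injective R (FractionRing R)
    rw [one_mul, map_mul, hq, mul_div_cancel₀ _ hdK]

theorem exists_colon_of_isAssociatedPrime {R : Type*} [CommRing R] [IsNoetherianRing R]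
    {P : Ideal R} {d : R} (h : IsAssociatedPrime P (R ⧸ Ideal.span {d})) :
    ∃ y, ∀ x, x ∈ P ↔ d ∣ x * y := by
  obtain ⟨-, m, rfl⟩ := isAssociatedPrime_iff.1 h
  obtain ⟨y, rfl⟩ := Ideal.Quotient.mk_surjective m
  refine ⟨y, fun x => ?_⟩
  rw [Submodule.mem_colon_singleton, Submodule.mem_bot, ← Ideal.mem_span_singleton,
    ← Ideal.Quotient.eq_zero_iff_mem, map_mul]
  rfl

/-- In a Noetherian integrally closed domain, an ideal `I` of height at least two satisfies
`((d) : I) = (d)` for every `d ≠ 0`. -/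
theorem dvd_of_two_le_height {R : Type*} [CommRing R] [IsDomain R]
    [IsNoetherianRing R] [IsIntegrallyClosed R] {I : Ideal R} (hI : 2 ≤ I.height) {d x : R}
    (hd : d ≠ 0) (h : ∀ z ∈ I, d ∣ z * x) : d ∣ x := by
  by_contra hx
  obtain ⟨P, hP, hle⟩ := exists_le_isAssociatedPrime_of_isNoetherianRing R
    (Ideal.Quotient.mk (Ideal.span {d}) x)
    (by rwa [Ne, Ideal.Quotient.eq_zero_iff_mem, Ideal.mem_span_singleton])
  have hIP : I ≤ P := by
    intro z hz
    refine hle ?_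
    rw [Submodule.mem_colon_singleton, Submodule.mem_bot]
    change Ideal.Quotient.mk (Ideal.span {d}) (z * x) = 0
    rw [Ideal.Quotient.eq_zero_iff_mem, Ideal.mem_span_singleton]
    exact h z hz
  have := hP.isPrime
  obtain ⟨y, hy⟩ := exists_colon_of_isAssociatedPrime hP
  obtain ⟨t, ht, u, hu, -, htu⟩ := exists_notMem_forall_dvd_mul_of_prime_colon hd hy
  -- P is locally generated by t, so Krull's principal ideal theorem bounds its height by one.
  have hmin : P ∈ (Ideal.span {t}).minimalPrimes := by
    refine ⟨⟨this, by simpa [Ideal.span_le] using ht⟩, fun Q ⟨hQ, htQ⟩ hQP z hz => ?_⟩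
    have hzu : z * u ∈ Q := htQ (Ideal.mem_span_singleton.2 (htu z hz))
    exact (hQ.mem_or_mem hzu).resolve_right fun hu' => hu (hQP hu')
  have h1 := Ideal.height_le_one_of_isPrincipal_of_mem_minimalPrimes _ P hmin
  exact absurd ((hI.trans (Ideal.height_mono hIP)).trans h1) (by decide)

/-- A nonzero prime of height less than two in a Noetherian integrally closed domain is locally
principal. -/
theorem exists_notMem_forall_dvd_mul_of_height_lt_two {R : Type*} [CommRing R] [IsDomain R]
    [IsNoetherianRing R] [IsIntegrallyClosed R] {P : Ideal R} [hP : P.IsPrime]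
    (hP0 : P ≠ ⊥) (hP2 : P.height < 2) :
    ∃ t ∈ P, ∃ u ∉ P, t ≠ 0 ∧ ∀ z ∈ P, t ∣ z * u := by
  obtain ⟨d, hdP, hd⟩ := Submodule.exists_mem_ne_zero_of_ne_bot hP0
  have hmin : P ∈ (Ideal.span {d}).minimalPrimes := by
    refine ⟨⟨hP, by simpa [Ideal.span_le] using hdP⟩, fun Q ⟨hQ, hdQ⟩ hQP => ?_⟩
    by_contra hne
    have hQ0 : Q ≠ ⊥ := by
      rintro rfl
      exact hd (by simpa using hdQ)
    have h1 := Ideal.height_add_one_le_of_lt_of_isPrime (lt_of_le_not_ge hQP hne)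
    have h2 : 1 ≤ Q.height :=
      Order.one_le_iff_pos.2 (pos_iff_ne_zero.2 (mt Ideal.height_eq_zero_iff_eq_bot.1 hQ0))
    exact absurd (((add_le_add_left h2 1).trans h1).trans_lt hP2) (by decide)
  rw [← Ideal.annihilator_quotient (I := Ideal.span {d})] at hmin
  obtain ⟨y, hy⟩ := exists_colon_of_isAssociatedPrime
    (Module.associatedPrimes.minimalPrimes_annihilator_subset_associatedPrimes R _ hmin)
  exact exists_notMem_forall_dvd_mul_of_prime_colon hd hy

theorem two_le_height_of_forall_prime {R : Type*} [CommRing R] {I : Ideal R}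
    (h : ∀ P : Ideal R, P.IsPrime → I ≤ P → 2 ≤ P.height) : 2 ≤ I.height := by
  rw [Ideal.height_eq_inf_minimalPrimes]
  exact le_iInf₂ fun P hP => h P hP.1.1 hP.1.2

/-! ### Minors and linear dependence of columns -/

/-- A matrix over a field with `s` columns, all of whose `s`-minors vanish, has a nonzero kernel. -/
theorem exists_ne_zero_of_minors_eq_zero_field {K m : Type*} [Field K] {s : ℕ}
    (A : Matrix m (Fin s) K) (h : ∀ p : Fin s → m, (A.submatrix p id).det = 0) :
    ∃ a : Fin s → K, a ≠ 0 ∧ ∀ k, ∑ j, A k j * a j = 0 := by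
  classical
  rcases eq_or_ne (Submodule.span K (Set.range A.row)) ⊤ with hs | hs
  · exfalso
    obtain ⟨κ, r, -, hspan, hli⟩ := exists_linearIndependent' K A.row
    let b : Module.Basis κ K (Fin s → K) := Module.Basis.mk hli (by rw [hspan, hs])
    have e : Fin s ≃ κ := (Pi.basisFun K (Fin s)).indexEquiv b
    have hunit := Matrix.linearIndependent_rows_iff_isUnit.1
      (show LinearIndependent K (A.submatrix (r ∘ e) id).row from hli.comp e e.injective)
    exact ((Matrix.isUnit_iff_isUnit_det _).1 hunit).ne_zero (h _)
  -- A nonzero functional killing a proper row span is, in coordinates, a kernel vector.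
  · obtain ⟨f, hf, hle⟩ := Submodule.exists_le_ker_of_lt_top _ (lt_top_iff_ne_top.2 hs)
    have key : ∀ v, f v = ∑ j, v j * f (Pi.single j 1) := fun v => by
      conv_lhs => rw [pi_eq_sum_univ' v]
      simp
    refine ⟨fun j => f (Pi.single j 1), fun h0 => hf ?_, fun k => ?_⟩
    · ext j
      simpa using congrFun h0 j
    · exact (key (A k)).symm.trans (hle (Submodule.subset_span ⟨k, rfl⟩))

/-- Solve over the fraction field, then clear denominators. -/
theorem exists_ne_zero_of_minors_eq_zero {S m : Type*} [CommRing S] [IsDomain S] {s : ℕ}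
    (A : Matrix m (Fin s) S) (h : ∀ p : Fin s → m, (A.submatrix p id).det = 0) :
    ∃ a : Fin s → S, a ≠ 0 ∧ ∀ k, ∑ j, A k j * a j = 0 := by
  let K := FractionRing S
  have hinj := IsFractionRing.injective S K
  obtain ⟨a, ha, hk⟩ := exists_ne_zero_of_minors_eq_zero_field (A.map (algebraMap S K)) fun p => by
    have := RingHom.map_det (algebraMap S K) (A.submatrix p id)
    rw [h p, map_zero] at this
    exact this.symm
  obtain ⟨c, hc⟩ := IsLocalization.exist_integer_multiples_of_finite (nonZeroDivisors S) a
  choose b hb using hc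
  have hc0 : algebraMap S K c ≠ 0 := by simp
  simp only [Algebra.smul_def] at hb
  refine ⟨b, fun h0 => ha ?_, fun k => hinj ?_⟩
  · ext j
    have := hb j
    rw [h0, Pi.zero_apply, map_zero] at this
    exact (mul_eq_zero.1 this.symm).resolve_left hc0
  · simp only [map_sum, map_mul, hb, map_zero]
    have := congrArg (algebraMap S K c * ·) (hk k)
    simp only [Matrix.map_apply, mul_zero] at this
    rw [← this, Finset.mul_sum]
    exact Finset.sum_congr rfl fun j _ => by ring

/-- If all `s`-minors of a matrix with `s` columns lie in a prime `P`, its columns are linearly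
dependent modulo `P`. -/
theorem exists_notMem_of_matrixMinorIdeal_le {R m : Type*} [CommRing R] {s : ℕ}
    (A : Matrix m (Fin s) R) {P : Ideal R} [P.IsPrime] (h : matrixMinorIdeal s A ≤ P) :
    ∃ a : Fin s → R, (∃ i, a i ∉ P) ∧ ∀ k, (∑ j, A k j * a j) ∈ P := by
  obtain ⟨a, ha, hk⟩ := exists_ne_zero_of_minors_eq_zero (A.map (Ideal.Quotient.mk P)) fun p => by
    have := RingHom.map_det (Ideal.Quotient.mk P) (A.submatrix p id)
    rw [Ideal.Quotient.eq_zero_iff_mem.2 (h (det_submatrix_mem s A p id))] at this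
    exact this.symm
  choose b hb using fun j => Ideal.Quotient.mk_surjective (a j)
  obtain ⟨i, hi⟩ := Function.ne_iff.1 ha
  refine ⟨b, ⟨i, fun hbi => hi ?_⟩, fun k => ?_⟩
  · rw [← hb i, Ideal.Quotient.eq_zero_iff_mem.2 hbi, Pi.zero_apply]
  · rw [← Ideal.Quotient.eq_zero_iff_mem, map_sum]
    simpa [hb] using hk k

/-- Cramer's rule: if `A a` is divisible by `d`, then so is every multiple of each coordinate of
`a` by an `s`-minor of `A`. -/
theorem dvd_mul_of_mem_matrixMinorIdeal {R m : Type*} [CommRing R] {s : ℕ}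
    (A : Matrix m (Fin s) R) (a : Fin s → R) {d : R} (h : ∀ k, d ∣ ∑ j, A k j * a j) (i : Fin s)
    {z : R} (hz : z ∈ matrixMinorIdeal s A) : d ∣ z * a i := by
  have hle : matrixMinorIdeal s A ≤ Submodule.comap (LinearMap.mulRight R (a i)) (Ideal.span {d}) := by
    refine Ideal.span_le.2 ?_
    rintro _ ⟨p, q, rfl⟩
    simp only [SetLike.mem_coe, Submodule.mem_comap, LinearMap.mulRight_apply,
      Ideal.mem_span_singleton]
    let e : Fin s ≃ Fin s := Equiv.ofBijective q (Finite.injective_iff_bijective.1 q.injective)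
    have hmul : (A.submatrix p q) *ᵥ (a ∘ e) = fun k => ∑ j, A (p k) j * a j := by
      ext k
      exact e.sum_comp fun j => A (p k) j * a j
    have hc : (A.submatrix p q).det • (a ∘ e) =
        (A.submatrix p q).adjugate *ᵥ (fun k => ∑ j, A (p k) j * a j) := by
      rw [← hmul, Matrix.mulVec_mulVec, Matrix.adjugate_mul, Matrix.smul_mulVec, Matrix.one_mulVec]
    have := congrFun hc (e.symm i)
    simp only [Pi.smul_apply, Function.comp_apply, Equiv.apply_symm_apply, smul_eq_mul] at this
    rw [this]
    exact Finset.dvd_sum (s := Finset.univ) fun k _ => (h (p k)).mul_left _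
  exact Ideal.mem_span_singleton.1 (hle hz)

theorem repr_apply_eq_sum_matrixOf {R F m : Type*} [CommRing R] [AddCommGroup F] [Module R F]
    {s : ℕ} (c : Module.Basis m R F) (f : (Fin s → R) →ₗ[R] F) (a : Fin s → R) (k : m) :
    c.repr (f a) k = ∑ j, matrixOf (Pi.basisFun R (Fin s)) c f k j * a j := by
  conv_lhs => rw [← (Pi.basisFun R (Fin s)).sum_repr a]
  simp [matrixOf, Finsupp.finsetSum_apply, mul_comm]

theorem exists_smul_eq_of_forall_dvd_repr {R F m : Type*} [CommRing R] [AddCommGroup F]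
    [Module R F] (c : Module.Basis m R F) {d : R} {x : F} (h : ∀ k, d ∣ c.repr x k) :
    ∃ y, x = d • y := by
  choose w hw using h
  refine ⟨∑ k ∈ (c.repr x).support, w k • c k, ?_⟩
  conv_lhs => rw [← c.linearCombination_repr x, Finsupp.linearCombination_apply, Finsupp.sum]
  rw [Finset.smul_sum]
  exact Finset.sum_congr rfl fun k _ => by rw [smul_smul, ← hw]

theorem isTorsionFree_quotient_iff {R M : Type*} [CommRing R] [IsDomain R] [AddCommGroup M]
    [Module R M] (N : Submodule R M) :
    Module.IsTorsionFree R (M ⧸ N) ↔ ∀ (d : R) (m : M), d ≠ 0 → d • m ∈ N → m ∈ N := by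
  rw [Module.isTorsionFree_iff_smul_eq_zero]
  constructor
  · intro h d m hd hm
    have : d • (Submodule.Quotient.mk m : M ⧸ N) = 0 := by
      rwa [← Submodule.Quotient.mk_smul, Submodule.Quotient.mk_eq_zero]
    exact (Submodule.Quotient.mk_eq_zero N).1 ((h _ _ this).resolve_left hd)
  · intro h d m hm
    obtain ⟨m, rfl⟩ := Submodule.Quotient.mk_surjective N m
    rw [← Submodule.Quotient.mk_smul, Submodule.Quotient.mk_eq_zero] at hm
    exact or_iff_not_imp_left.2 fun hd => (Submodule.Quotient.mk_eq_zero N).2 (h d m hd hm)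

/-! ### Torsion-free cokernels and height -/

theorem two_le_height_minorIdeal_of_isTorsionFree {R M F X : Type*} [CommRing R] [IsDomain R]
    [IsNoetherianRing R] [IsIntegrallyClosed R] [AddCommGroup M] [Module R M]
    [AddCommGroup F] [Module R F] [Module.Free R F]
    [AddCommGroup X] [Module R X] [Module.IsTorsionFree R X] {s : ℕ} {φ : (Fin s → R) →ₗ[R] M}
    {ι : M →ₗ[R] F} {π : F →ₗ[R] X} (hι : Function.Injective ι) (hιπ : Function.Exact ι π)
    (hφ : Function.Injective φ) (hC : Module.IsTorsionFree R (M ⧸ LinearMap.range φ)) :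
    2 ≤ (minorIdeal s (ι ∘ₗ φ)).height := by
  let c := Module.Free.chooseBasis R F
  rw [minorIdeal_eq (Pi.basisFun R (Fin s)) c]
  refine two_le_height_of_forall_prime fun P hP hle => ?_
  by_contra! hP2
  obtain ⟨a, ⟨i, hi⟩, ha⟩ := exists_notMem_of_matrixMinorIdeal_le _ hle
  simp only [← repr_apply_eq_sum_matrixOf] at ha
  have hP0 : P ≠ ⊥ := by
    rintro rfl
    have h0 : (ι ∘ₗ φ) a = 0 := c.ext_elem fun k => by simpa using ha k
    have : a = 0 := hφ (hι (by simpa using h0))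
    exact hi (by simp [this])
  obtain ⟨t, ht, u, hu, ht0, htu⟩ := exists_notMem_forall_dvd_mul_of_height_lt_two hP0 hP2
  obtain ⟨y, hy⟩ := exists_smul_eq_of_forall_dvd_repr c (d := t) (x := (ι ∘ₗ φ) (u • a)) fun k => by
    rw [map_smul, map_smul, Finsupp.smul_apply, smul_eq_mul, mul_comm]
    exact htu _ (ha k)
  have hπy : π y = 0 := by
    have : t • π y = 0 := by
      rw [← map_smul, ← hy]
      exact hιπ.apply_apply_eq_zero _
    exact (smul_eq_zero.1 this).resolve_left ht0
  obtain ⟨m, rfl⟩ := (hιπ y).1 hπy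
  have hm : φ (u • a) = t • m := hι (by simpa using hy)
  obtain ⟨b, rfl⟩ := (isTorsionFree_quotient_iff _).1 hC t m ht0 (hm ▸ ⟨_, rfl⟩)
  have hab : u • a = t • b := hφ (by rw [hm, map_smul])
  have hai : u * a i = t * b i := congrFun hab i
  exact (hP.mem_or_mem (hai ▸ P.mul_mem_right _ ht)).elim hu hi

theorem injective_of_two_le_height_minorIdeal {R F : Type*} [CommRing R] [IsDomain R]
    [AddCommGroup F] [Module R F] [Module.Free R F] {s : ℕ} {ψ : (Fin s → R) →ₗ[R] F}
    (h : 2 ≤ (minorIdeal s ψ).height) : Function.Injective ψ := by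
  let c := Module.Free.chooseBasis R F
  rw [minorIdeal_eq (Pi.basisFun R (Fin s)) c] at h
  refine (injective_iff_map_eq_zero ψ).2 fun a ha => funext fun i => ?_
  obtain ⟨z, hz, hz0⟩ := Submodule.exists_mem_ne_zero_of_ne_bot (p := matrixMinorIdeal s
    (matrixOf (Pi.basisFun R (Fin s)) c ψ)) (by rintro h0; simp [h0] at h)
  -- Divisibility by 0 turns Cramer's rule into z a_i = 0.
  have := dvd_mul_of_mem_matrixMinorIdeal _ a (d := 0) (fun k => by
    rw [← repr_apply_eq_sum_matrixOf, ha]; simp) i hz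
  exact (mul_eq_zero.1 (zero_dvd_iff.1 this)).resolve_left hz0

theorem isTorsionFree_quotient_of_two_le_height_minorIdeal {R M F : Type*} [CommRing R]
    [IsDomain R] [IsNoetherianRing R] [IsIntegrallyClosed R] [AddCommGroup M] [Module R M]
    [AddCommGroup F] [Module R F] [Module.Free R F] {s : ℕ} {φ : (Fin s → R) →ₗ[R] M}
    {ι : M →ₗ[R] F} (hι : Function.Injective ι)
    (h : 2 ≤ (minorIdeal s (ι ∘ₗ φ)).height) :
    Module.IsTorsionFree R (M ⧸ LinearMap.range φ) := by
  let c := Module.Free.chooseBasis R F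
  rw [minorIdeal_eq (Pi.basisFun R (Fin s)) c] at h
  refine (isTorsionFree_quotient_iff _).2 ?_
  rintro d m hd ⟨a, ha⟩
  have hdvd : ∀ i, d ∣ a i := fun i => dvd_of_two_le_height h hd fun z hz =>
    dvd_mul_of_mem_matrixMinorIdeal _ a (fun k => by
      rw [← repr_apply_eq_sum_matrixOf, LinearMap.comp_apply, ha, map_smul, map_smul]
      exact dvd_mul_right _ _) i hz
  choose b hb using hdvd
  refine ⟨b, hι (smul_right_injective F hd ?_)⟩
  change d • ι (φ b) = d • ι m
  rw [← map_smul, ← map_smul, ← map_smul, ← ha]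
  congr 2
  exact (funext hb).symm

/-! ### Rank one and the theorem -/

/-- A finitely generated torsion-free module of rank one over a domain is isomorphic to an ideal. -/
theorem exists_linearEquiv_ideal_of_finrank_eq_one {R C : Type*} [CommRing R] [IsDomain R]
    [AddCommGroup C] [Module R C] [Module.Finite R C] [Module.IsTorsionFree R C]
    (h : Module.finrank R C = 1) : ∃ I : Ideal R, Nonempty (C ≃ₗ[R] I) := by
  have : Nontrivial C := Module.nontrivial_of_finrank_pos (R := R) (by lia)
  obtain ⟨c, hc⟩ := exists_ne (0 : C)
  have hdep : ∀ x : C, ∃ d : R, d ≠ 0 ∧ d • x ∈ Submodule.span R {c} := by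
    intro x
    have hli : ¬ LinearIndependent R ![c, x] := fun hli => by
      have := hli.fintype_card_le_finrank
      simp [h] at this
    rw [LinearIndependent.pair_iff] at hli
    push Not at hli
    obtain ⟨α, β, hαβ, hne⟩ := hli
    refine ⟨β, ?_, Submodule.mem_span_singleton.2 ⟨-α, ?_⟩⟩
    · rintro rfl
      rw [zero_smul, add_zero] at hαβ
      exact hne ((smul_eq_zero.1 hαβ).resolve_right hc) rfl
    · rw [neg_smul, neg_eq_iff_add_eq_zero, hαβ]
  choose δ hδ0 hδ using hdep
  obtain ⟨T, hT⟩ := (Module.Finite.fg_top : (⊤ : Submodule R C).FG)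
  -- A common denominator for the generators: multiplication by d embeds C into Rc ≅ R.
  let d : R := T.prod δ
  have hd : d ≠ 0 := Finset.prod_ne_zero_iff.2 fun x _ => hδ0 x
  have hmem : ∀ x : C, d • x ∈ Submodule.span R {c} := by
    have hle : (⊤ : Submodule R C) ≤ (Submodule.span R {c}).comap (LinearMap.lsmul R C d) := by
      rw [← hT, Submodule.span_le]
      intro x hx
      obtain ⟨e, he⟩ : δ x ∣ d := Finset.dvd_prod_of_mem δ hx
      change d • x ∈ Submodule.span R {c}
      rw [he, mul_comm, mul_smul]
      exact Submodule.smul_mem _ e (hδ x)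
    exact fun x => hle (Submodule.mem_top : x ∈ ⊤)
  let f : C →ₗ[R] R := (LinearEquiv.toSpanNonzeroSingleton R C c hc).symm.toLinearMap ∘ₗ
    (LinearMap.lsmul R C d).codRestrict _ hmem
  have hf : Function.Injective f := by
    intro x y hxy
    exact smul_right_injective C hd (congrArg Subtype.val
      ((LinearEquiv.toSpanNonzeroSingleton R C c hc).symm.injective hxy))
  exact ⟨LinearMap.range f, ⟨LinearEquiv.ofInjective f hf⟩⟩

end BourbakiSeq

theorem theorem4p2 {R M F X : Type*} [CommRing R] [IsDomain R] [IsNoetherianRing R]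
    [IsIntegrallyClosed R] (hdim : 2 ≤ ringKrullDim R)
    [AddCommGroup M] [Module R M] [Module.Finite R M] [Module.IsReflexive R M]
    [AddCommGroup F] [Module R F] [Module.Free R F]
    [AddCommGroup X] [Module R X] [Module.IsTorsionFree R X]
    (s : ℕ) (φ : (Fin s → R) →ₗ[R] M)
    (ι : M →ₗ[R] F) (π : F →ₗ[R] X) (hι : Function.Injective ι) (hιπ : Function.Exact ι π)
    (hπ : Function.Surjective π) :
    ((Function.Injective φ ∧ Module.IsTorsionFree R (M ⧸ LinearMap.range φ)) ↔
      2 ≤ (BourbakiSeq.minorIdeal s (ι ∘ₗ φ)).height) ∧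
    (Module.finrank R M = s + 1 →
      (BourbakiSeq.IsBourbakiSequence φ (LinearMap.range φ).mkQ ↔
        2 ≤ (BourbakiSeq.minorIdeal s (ι ∘ₗ φ)).height))
 := by
  have main : (Function.Injective φ ∧ Module.IsTorsionFree R (M ⧸ LinearMap.range φ)) ↔
      2 ≤ (BourbakiSeq.minorIdeal s (ι ∘ₗ φ)).height := by
    refine ⟨fun h => BourbakiSeq.two_le_height_minorIdeal_of_isTorsionFree hι hιπ h.1 h.2,
      fun h => ⟨?_, BourbakiSeq.isTorsionFree_quotient_of_two_le_height_minorIdeal hι h⟩⟩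
    have := BourbakiSeq.injective_of_two_le_height_minorIdeal h
    rw [LinearMap.coe_comp] at this
    exact this.of_comp
  refine ⟨main, fun hM => ?_⟩
  rw [← main]
  constructor
  · intro h
    obtain ⟨I, ⟨e⟩⟩ := h.ideal
    refine ⟨h.injective, ?_⟩
    exact (Subtype.val_injective.comp e.injective).moduleIsTorsionFree _ (by simp)
  · rintro ⟨hφ, hC⟩
    refine ⟨inferInstance, hφ, LinearMap.exact_map_mkQ_range φ, Submodule.mkQ_surjective _,
      BourbakiSeq.exists_linearEquiv_ideal_of_finrank_eq_one ?_⟩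
    -- Additivity of rank: the cokernel has rank (s + 1) - s = 1.
    have h1 := (LinearMap.range φ).finrank_quotient_add_finrank
    rw [LinearMap.finrank_range_of_inj hφ, Module.finrank_fin_fun, hM] at h1
    lia
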